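/- **Proposition (signature pruning).** Let $a\le b$ be real, $d,N\in\mathbb{N}_0$, and fix a notion of integration on $[a,b]$ as follows. Let $(\pi_m)_{m\ge 1}$ be a sequence of finite partitions of $[a,b]$ whose mesh tends to $0$, and let $\theta\in[0,1]$. For $Y,Z:[a,b]\to\mathbb{R}$ the integral $t\mapsto\int_a^t Y\,\mathrm{d}Z$ is *well defined* if the Riemann sums $$\sum_{[s,s']\in\pi_m}\big((1-\theta)Y_s+\theta Y_{s'}\big)\,\big(Z_{s'\wedge t}-Z_{s\wedge t}\big)$$ converge as $m\to\infty$, uniformly in $t\in[a,b]$; the integral is then their limit. (For paths of finite $p$-variation with $p<2$ this is the Riemann–Stieltjes/Young integral, for every choice of $(\pi_m)$ and $\theta$; $\theta=0$ gives the Itô and $\theta=\tfrac12$ the Stratonovich integral along $(\pi_m)$.) For a continuous path $X=(X^1,\dots,X^d):[a,b]\to\mathbb{R}^d$ let $\hat X_t=(\hat X^0_t,\dots,\hat X^d_t)=(t,X_t)$ be its time augmentation. For a word $w=(i_1,\dots,i_k)$ in the letters $\{0,\dots,d\}$, of length $|w|=k$, let $$\mathrm{Sig}^w(\hat X)=\int_{a<u_1<\dots<u_k<b}\mathrm{d}\hat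 X^{i_1}_{u_1}\cdots \mathrm{d}\hat X^{i_k}_{u_k},$$ understood as an iterated integral, the integration against $\hat X^{i_k}$ being the outermost one. Let $\mathcal{P}_N$ be the set of all continuous paths $X$ for which all these iterated integrals of order at most $N$ (as functions of the upper limit) are well defined. Let $w$ be a word with $|w|\le N$ whose last letter is the time letter $0$. Then the functional $X\mapsto \mathrm{Sig}^w(\hat X)$ on $\mathcal{P}_N$ lies in the real linear span of $$B_N=\{\,\mathrm{Sig}^v(\hat{\,\cdot\,}) : v \text{ a non-empty word},\ |v|\le N,\ \text{last letter of } v \ne 0\,\}\cup\{1\},$$ where $1$ is the constant functional. In other words, there are real coefficients $c$ and $(c_v)_v$, the same for all $X\in\mathcal{P}_N$, such that $\mathrm{Sig}^w(\hat X)=c+\sum_{v} c_v\,\mathrm{Sig}^v(\hat X)$ for all $X\in\mathcal{P}_N$, where the sum runs over the non-empty words $v$ with $|v|\le N$ whose last letter is not $0$. -/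

import Mathlib

namespace PathSignature

/-- A finite partition `a = t₀ ≤ t₁ ≤ ⋯ ≤ tₙ = b` of the interval `[a, b]`
(only the values `pt 0, …, pt n` matter). -/
structure Partition (a b : ℝ) where
  /-- the number of subintervals -/
  n : ℕ
  /-- the partition points -/
  pt : ℕ → ℝ
  pt_zero : pt 0 = a
  pt_last : pt n = b
  mono : ∀ k < n, pt k ≤ pt (k + 1)

/-- The mesh of a partition: the length of its longest subinterval. -/
noncomputable def Partition.mesh {a b : ℝ} (P : Partition a b) : ℝ :=
  ⨆ k : Fin P.n, (P.pt (k + 1) - P.pt k)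

/-- The Riemann sum of `∫_a^t Y dZ` along the partition `P`, with `Y` replaced on `[tₖ, tₖ₊₁]` by
`(1 - θ) Y(tₖ) + θ Y(tₖ₊₁)`: the left-point (Itô) sum for `θ = 0`, the trapezoidal
(Stratonovich) sum for `θ = 1/2`. The integrator is stopped at `t`. -/
noncomputable def riemannSum {a b : ℝ} (θ : ℝ) (P : Partition a b) (Y Z : ℝ → ℝ) (t : ℝ) : ℝ :=
  ∑ k ∈ Finset.range P.n,
    ((1 - θ) * Y (P.pt k) + θ * Y (P.pt (k + 1))) * (Z (min (P.pt (k + 1)) t) - Z (min (P.pt k) t))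

/-- The indefinite integral `t ↦ ∫_a^t Y dZ`, the limit of the Riemann sums along the sequence `π`
of partitions of `[a, b]`. -/
noncomputable def integral {a b : ℝ} (θ : ℝ) (π : ℕ → Partition a b) (Y Z : ℝ → ℝ) (t : ℝ) : ℝ :=
  Filter.limUnder Filter.atTop (fun m => riemannSum θ (π m) Y Z t)

/-- The integral `t ↦ ∫_a^t Y dZ` is well defined: its Riemann sums converge, uniformly in
`t ∈ [a, b]`. -/
def Integrable {a b : ℝ} (θ : ℝ) (π : ℕ → Partition a b) (Y Z : ℝ → ℝ) : Prop :=
  TendstoUniformlyOn (fun m t => riemannSum θ (π m) Y Z t) (integral θ π Y Z)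
    Filter.atTop (Set.Icc a b)

/-- Iterated integrals of a path `x`, for words read backwards: the value at `[iₖ, …, i₁]` and `t`
is `∫_{a < u₁ < ⋯ < uₖ < t} dx^{i₁}_{u₁} ⋯ dx^{iₖ}_{uₖ}`, where the outermost integral is the one
against the coordinate `iₖ`. -/
noncomputable def iterRev {a b : ℝ} {ι : Type*} (θ : ℝ) (π : ℕ → Partition a b)
    (x : ℝ → ι → ℝ) : List ι → ℝ → ℝ
  | [] => fun _ => 1
  | i :: u => integral θ π (iterRev θ π x u) (fun t => x t i)

/-- The signature coordinate of the path `x` on `[a, b]` at the word `w = [i₁, …, iₖ]`: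
`∫_{a < u₁ < ⋯ < uₖ < b} dx^{i₁}_{u₁} ⋯ dx^{iₖ}_{uₖ}`. -/
noncomputable def sig {a b : ℝ} {ι : Type*} (θ : ℝ) (π : ℕ → Partition a b)
    (w : List ι) (x : ℝ → ι → ℝ) : ℝ :=
  iterRev θ π x w.reverse b

/-- All iterated integrals of `x` of order at most `N` are well defined. -/
def HasSignature {a b : ℝ} {ι : Type*} (θ : ℝ) (π : ℕ → Partition a b) (N : ℕ)
    (x : ℝ → ι → ℝ) : Prop :=
  ∀ (u : List ι) (i : ι), u.length < N → Integrable θ π (iterRev θ π x u) (fun t => x t i)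

/-- The time-augmented path `X̂ = (t, X)`; the coordinate `0` is time. -/
def timeAugment {d : ℕ} (X : ℝ → EuclideanSpace ℝ (Fin d)) : ℝ → Fin (d + 1) → ℝ :=
  fun t => Fin.cons t (fun j => X t j)

/-- The continuous paths `X : [a, b] → ℝᵈ` whose time augmentation has a well-defined depth-`N`
signature (values outside `[a, b]` play no role). -/
def paths {a b : ℝ} (d : ℕ) (θ : ℝ) (π : ℕ → Partition a b) (N : ℕ) :
    Set (ℝ → EuclideanSpace ℝ (Fin d)) :=
  {X | ContinuousOn X (Set.Icc a b) ∧ HasSignature θ π N (timeAugment X)}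

/-- The signature coordinate `X ↦ Sig^w(X̂)` as a functional on path space. -/
noncomputable def coord {a b : ℝ} (d : ℕ) (θ : ℝ) (π : ℕ → Partition a b) (N : ℕ)
    (w : List (Fin (d + 1))) : paths d θ π N → ℝ :=
  fun X => sig θ π w (timeAugment X.1)

/-- `B_N`: the coordinates of the words of length at most `N` whose last letter is not the time
letter `0`, together with the constant `1`, all as functionals on path space. -/
def prunedSet {a b : ℝ} (d : ℕ) (θ : ℝ) (π : ℕ → Partition a b) (N : ℕ) :
    Set (paths d θ π N → ℝ) :=
  {f | ∃ v : List (Fin (d + 1)), v.length ≤ N ∧ (∃ i, v.getLast? = some i ∧ i ≠ 0) ∧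
    f = coord d θ π N v} ∪ {fun _ => 1}

end PathSignature

/-!
Write `I^w` for the iterated integral of the word `w` as a function of its upper limit `t`. The
engine is the shuffle identity with the single letter `0`,
`(t - a) * I^w t = ∑ I^v t`, the sum being over all insertions `v` of one letter `0` into `w`
(`sub_mul_iterRev`). It follows by induction on `w` from the integration by parts formula
`(t - a) * ∫ V dZ = ∫ (s - a) V dZ + ∫ (∫ V dZ) ds` (`tendsto_riemannSum_add`), which holds for
every admissible notion of integration, whatever the roughness of `Z`: on the level of Riemann sums
it is Abel summation, up to errors controlled by the moduli of continuity of `Z` and of the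
indefinite integral (`abs_riemannSum_add_sub_le`).

Insert a `0` into `u 0ᵏ`, where `u` does not end in `0`. The words obtained are `k + 1` copies of
`u 0ᵏ⁺¹` and, when `u = u' i`, the words `v i 0ᵏ` with `v` an insertion of `0` into `u'`
(`sum_insertions_replicate_append_cons`). At `t = b` the shuffle identity thus expresses the word
`u 0ᵏ⁺¹` through words with at most `k` trailing zeros and of no greater length, and induction on
the number of trailing zeros finishes the proof (`coord_trailing_zeros_mem`).

Words are written backwards where iterated integrals are concerned, as in `iterRev`.
-/

namespace PathSignature

/-! ### Partitions -/

namespace Partition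

variable {a b : ℝ} (P : Partition a b)

lemma pt_le_pt {i j : ℕ} (hij : i ≤ j) (hj : j ≤ P.n) : P.pt i ≤ P.pt j := by
  induction j, hij using Nat.le_induction with
  | base => exact le_rfl
  | succ j _ ih => exact (ih (by omega)).trans (P.mono j (by omega))

lemma pt_mem_Icc {k : ℕ} (hk : k ≤ P.n) : P.pt k ∈ Set.Icc a b := by
  have h0 := P.pt_le_pt (Nat.zero_le k) hk
  have h1 := P.pt_le_pt hk le_rfl
  rw [P.pt_zero] at h0
  rw [P.pt_last] at h1
  exact ⟨h0, h1⟩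

lemma min_pt_mem_Icc {k : ℕ} (hk : k ≤ P.n) {t : ℝ} (ht : t ∈ Set.Icc a b) :
    min (P.pt k) t ∈ Set.Icc a b :=
  ⟨le_min (P.pt_mem_Icc hk).1 ht.1, (min_le_right _ _).trans ht.2⟩

lemma sub_le_mesh {k : ℕ} (hk : k < P.n) : P.pt (k + 1) - P.pt k ≤ P.mesh :=
  le_ciSup (f := fun k : Fin P.n => P.pt (k + 1) - P.pt k) (Set.finite_range _).bddAbove ⟨k, hk⟩

end Partition

/-! ### Riemann sums and integration by parts -/

section Integral

variable {a b θ : ℝ}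

/-- A Riemann sum whose integrator is stopped at the time `min (P.pt k) t` is the partial sum over
the first `k` subintervals of the one stopped at `t`. -/
lemma riemannSum_min_pt (P : Partition a b) (V Z : ℝ → ℝ) (t : ℝ) {k : ℕ} (hk : k ≤ P.n) :
    riemannSum θ P V Z (min (P.pt k) t) = ∑ j ∈ Finset.range k,
      ((1 - θ) * V (P.pt j) + θ * V (P.pt (j + 1))) *
        (Z (min (P.pt (j + 1)) t) - Z (min (P.pt j) t)) := by
  unfold riemannSum
  symm
  rw [← Finset.sum_subset (Finset.range_mono hk)]
  · refine Finset.sum_congr rfl fun j hj => ?_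
    rw [Finset.mem_range] at hj
    rw [← min_assoc, ← min_assoc, min_eq_left (P.pt_le_pt (Nat.succ_le_of_lt hj) hk),
      min_eq_left (P.pt_le_pt hj.le hk)]
  · intro j hj hj'
    rw [Finset.mem_range] at hj hj'
    rw [← min_assoc, ← min_assoc, min_eq_right (P.pt_le_pt (by omega : k ≤ j + 1) (by omega)),
      min_eq_right (P.pt_le_pt (by omega : k ≤ j) (by omega)), sub_self, mul_zero]

lemma riemannSum_congr (P : Partition a b) {V W : ℝ → ℝ} (h : Set.EqOn V W (Set.Icc a b))
    (Z : ℝ → ℝ) (t : ℝ) : riemannSum θ P V Z t = riemannSum θ P W Z t := by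
  refine Finset.sum_congr rfl fun k hk => ?_
  rw [Finset.mem_range] at hk
  rw [h (P.pt_mem_Icc hk.le), h (P.pt_mem_Icc hk)]

lemma riemannSum_zero (P : Partition a b) (Z : ℝ → ℝ) (t : ℝ) :
    riemannSum θ P (fun _ => 0) Z t = 0 := by
  simp [riemannSum]

lemma riemannSum_add (P : Partition a b) (V W Z : ℝ → ℝ) (t : ℝ) :
    riemannSum θ P (fun s => V s + W s) Z t = riemannSum θ P V Z t + riemannSum θ P W Z t := by
  simp only [riemannSum, ← Finset.sum_add_distrib]
  exact Finset.sum_congr rfl fun k _ => by ring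

lemma riemannSum_one (P : Partition a b) (Z : ℝ → ℝ) {t : ℝ} (ht : t ∈ Set.Icc a b) :
    riemannSum θ P (fun _ => 1) Z t = Z t - Z a := by
  have h := Finset.sum_range_sub (fun k => Z (min (P.pt k) t)) P.n
  rw [P.pt_zero, P.pt_last, min_eq_right ht.2, min_eq_left ht.1] at h
  simpa [riemannSum] using h

lemma continuousOn_riemannSum (P : Partition a b) (V : ℝ → ℝ) {Z : ℝ → ℝ}
    (hZ : ContinuousOn Z (Set.Icc a b)) :
    ContinuousOn (fun t => riemannSum θ P V Z t) (Set.Icc a b) := by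
  have h : ∀ k ≤ P.n, ContinuousOn (fun t => Z (min (P.pt k) t)) (Set.Icc a b) := fun k hk =>
    hZ.comp (by fun_prop) fun t ht => P.min_pt_mem_Icc hk ht
  refine continuousOn_finsetSum _ fun k hk => ?_
  rw [Finset.mem_range] at hk
  exact continuousOn_const.mul ((h _ hk).sub (h _ hk.le))

/-- Integration by parts for Riemann sums, with explicit error. Here `Y` stands for the indefinite
integral `∫ V dZ`; `ε` and `η` bound the oscillations of `Z` and `Y` at the scale of the mesh. -/
lemma abs_riemannSum_add_sub_le (hθ : θ ∈ Set.Icc (0 : ℝ) 1) (P : Partition a b)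
    {V Z Y : ℝ → ℝ} {C ε η : ℝ} (hV : ∀ s ∈ Set.Icc a b, |V s| ≤ C)
    (hZ : ∀ s ∈ Set.Icc a b, ∀ s' ∈ Set.Icc a b, |s - s'| ≤ P.mesh → |Z s - Z s'| ≤ ε)
    (hY : ∀ s ∈ Set.Icc a b, ∀ s' ∈ Set.Icc a b, |s - s'| ≤ P.mesh → |Y s - Y s'| ≤ η)
    (hS : ∀ s ∈ Set.Icc a b, |Y s - riemannSum θ P V Z s| ≤ η)
    {t : ℝ} (ht : t ∈ Set.Icc a b) :
    |riemannSum θ P (fun s => (s - a) * V s) Z t + riemannSum θ P Y (fun s => s) t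
      - (t - a) * riemannSum θ P V Z t| ≤ (C * ε + 2 * η) * (b - a) := by
  obtain ⟨hθ0, hθ1⟩ := hθ
  set S := riemannSum θ P V Z with hSdef
  have htel : (t - a) * S t = ∑ k ∈ Finset.range P.n,
      ((min (P.pt (k + 1)) t - a) * S (min (P.pt (k + 1)) t)
        - (min (P.pt k) t - a) * S (min (P.pt k) t)) := by
    rw [Finset.sum_range_sub (fun k => (min (P.pt k) t - a) * S (min (P.pt k) t)),
      P.pt_zero, P.pt_last, min_eq_right ht.2, min_eq_left ht.1]
    ring
  have hlen : b - a = ∑ k ∈ Finset.range P.n, (P.pt (k + 1) - P.pt k) := by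
    rw [Finset.sum_range_sub P.pt, P.pt_zero, P.pt_last]
  rw [htel, hlen, Finset.mul_sum]
  unfold riemannSum
  rw [← Finset.sum_add_distrib, ← Finset.sum_sub_distrib]
  refine (Finset.abs_sum_le_sum_abs _ _).trans (Finset.sum_le_sum fun k hk => ?_)
  rw [Finset.mem_range] at hk
  have hstep : S (min (P.pt (k + 1)) t) = S (min (P.pt k) t) +
      ((1 - θ) * V (P.pt k) + θ * V (P.pt (k + 1))) *
        (Z (min (P.pt (k + 1)) t) - Z (min (P.pt k) t)) := by
    rw [hSdef, riemannSum_min_pt P V Z t hk, riemannSum_min_pt P V Z t hk.le,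
      Finset.sum_range_succ]
  have hmono := P.mono k hk
  have hmesh := P.sub_le_mesh hk
  have hp := P.pt_mem_Icc hk.le
  have hq := P.pt_mem_Icc (Nat.succ_le_of_lt hk)
  have hr := P.min_pt_mem_Icc (Nat.succ_le_of_lt hk) ht
  have hC : 0 ≤ C := (abs_nonneg _).trans (hV _ hp)
  have hε : 0 ≤ ε := (abs_nonneg _).trans (hZ _ hp _ hq (by rw [abs_le]; constructor <;> linarith))
  have hη : 0 ≤ η := (abs_nonneg _).trans (hS _ hp)
  rcases le_or_gt (P.pt k) t with hkt | hkt
  · -- The subinterval starts before `t`, so stopping does not affect its left end point.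
    rw [min_eq_left hkt] at hstep ⊢
    have hrq : min (P.pt (k + 1)) t ≤ P.pt (k + 1) := min_le_left _ _
    have hpr : P.pt k ≤ min (P.pt (k + 1)) t := le_min hmono hkt
    generalize min (P.pt (k + 1)) t = r at *
    generalize P.pt (k + 1) = q at *
    generalize P.pt k = p at *
    have hZr := hZ r hr p hp (by rw [abs_le]; constructor <;> linarith)
    have hYp := hY p hp r hr (by rw [abs_le]; constructor <;> linarith)
    have hYq := hY q hq r hr (by rw [abs_le]; constructor <;> linarith)
    have hSr := hS r hr
    have hYS : |(1 - θ) * Y p + θ * Y q - S r| ≤ 2 * η := by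
      have e : (1 - θ) * Y p + θ * Y q - S r
          = (1 - θ) * (Y p - Y r) + θ * (Y q - Y r) + (Y r - S r) := by ring
      rw [e]
      calc _ ≤ |(1 - θ) * (Y p - Y r)| + |θ * (Y q - Y r)| + |Y r - S r| := abs_add_three _ _ _
        _ = (1 - θ) * |Y p - Y r| + θ * |Y q - Y r| + |Y r - S r| := by
          rw [abs_mul, abs_mul, abs_of_nonneg hθ0, abs_of_nonneg (sub_nonneg.2 hθ1)]
        _ ≤ (1 - θ) * η + θ * η + η := by
          have := sub_nonneg.2 hθ1
          gcongr
        _ = 2 * η := by ring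
    have hVZ : |θ * (V q * (Z r - Z p))| ≤ C * ε := by
      rw [abs_mul, abs_mul, abs_of_nonneg hθ0]
      calc θ * (|V q| * |Z r - Z p|) ≤ 1 * (C * ε) := by
            gcongr
            exact hV q hq
        _ = C * ε := one_mul _
    have e : ((1 - θ) * ((p - a) * V p) + θ * ((q - a) * V q)) * (Z r - Z p)
        + ((1 - θ) * Y p + θ * Y q) * (r - p) - ((r - a) * S r - (p - a) * S p)
        = θ * (V q * (Z r - Z p)) * (q - p) + ((1 - θ) * Y p + θ * Y q - S r) * (r - p) := by
      linear_combination -(p - a) * hstep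
    rw [e]
    calc _ ≤ |θ * (V q * (Z r - Z p)) * (q - p)|
          + |((1 - θ) * Y p + θ * Y q - S r) * (r - p)| := abs_add_le _ _
      _ = |θ * (V q * (Z r - Z p))| * (q - p)
          + |(1 - θ) * Y p + θ * Y q - S r| * (r - p) := by
        rw [abs_mul, abs_mul _ (r - p), abs_of_nonneg (sub_nonneg.2 hmono),
          abs_of_nonneg (sub_nonneg.2 hpr)]
      _ ≤ C * ε * (q - p) + 2 * η * (q - p) := by
        have := sub_nonneg.2 hpr
        gcongr
      _ = (C * ε + 2 * η) * (q - p) := by ring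
  · -- The subinterval starts after `t`, and contributes nothing.
    rw [min_eq_right hkt.le, min_eq_right (hkt.le.trans hmono)]
    have := sub_nonneg.2 hmono
    simpa using by positivity

/-- **Integration by parts against time.** If `Y` is the indefinite integral of `V` against `Z`,
then `∫ (s - a) V dZ + ∫ Y ds` converges along the partitions and equals `(t - a) Y`. -/
lemma tendsto_riemannSum_add (hθ : θ ∈ Set.Icc (0 : ℝ) 1) {π : ℕ → Partition a b}
    (hπ : Filter.Tendsto (fun m => (π m).mesh) Filter.atTop (nhds 0)) {V Z Y : ℝ → ℝ}
    (hV : ContinuousOn V (Set.Icc a b)) (hZ : ContinuousOn Z (Set.Icc a b))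
    (hY : ContinuousOn Y (Set.Icc a b))
    (hVZ : TendstoUniformlyOn (fun m t => riemannSum θ (π m) V Z t) Y
      Filter.atTop (Set.Icc a b)) {t : ℝ} (ht : t ∈ Set.Icc a b) :
    Filter.Tendsto (fun m => riemannSum θ (π m) (fun s => (s - a) * V s) Z t
      + riemannSum θ (π m) Y (fun s => s) t) Filter.atTop (nhds ((t - a) * Y t)) := by
  obtain ⟨C, hC⟩ := isCompact_Icc.exists_bound_of_continuousOn hV
  have hC0 : 0 ≤ C := (norm_nonneg _).trans (hC t ht)
  have hab : 0 ≤ b - a := sub_nonneg.2 (ht.1.trans ht.2)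
  have key : Filter.Tendsto (fun m => riemannSum θ (π m) (fun s => (s - a) * V s) Z t
      + riemannSum θ (π m) Y (fun s => s) t - (t - a) * riemannSum θ (π m) V Z t)
      Filter.atTop (nhds 0) := by
    rw [Metric.tendsto_nhds]
    intro ε hε
    -- The total error for `ε = η = κ` is `(C + 2) * κ * (b - a)`, which is to be less than `ε`.
    set κ := ε / ((C + 2) * (b - a) + 1) with hκ
    have hden : 0 < (C + 2) * (b - a) + 1 := by positivity
    have hκ0 : 0 < κ := by positivity
    have hosc : ∀ {F : ℝ → ℝ}, ContinuousOn F (Set.Icc a b) → ∀ᶠ m in Filter.atTop,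
        ∀ s ∈ Set.Icc a b, ∀ s' ∈ Set.Icc a b, |s - s'| ≤ (π m).mesh → |F s - F s'| ≤ κ := by
      intro F hF
      obtain ⟨δ, hδ, h⟩ := Metric.uniformContinuousOn_iff.1
        (isCompact_Icc.uniformContinuousOn_of_continuous hF) κ hκ0
      filter_upwards [hπ.eventually_lt_const hδ] with m hm s hs s' hs' hss'
      exact (h s hs s' hs' (hss'.trans_lt hm)).le
    filter_upwards [hosc hZ, hosc hY, Metric.tendstoUniformlyOn_iff.1 hVZ κ hκ0] with m h1 h2 h3
    have h := abs_riemannSum_add_sub_le hθ (π m) hC h1 h2 (fun s hs => (h3 s hs).le) ht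
    rw [Real.dist_eq, sub_zero]
    refine h.trans_lt ?_
    have e : ((C + 2) * (b - a) + 1) * κ = ε := by rw [hκ]; field_simp
    linarith
  simpa using key.add ((hVZ.tendsto_at ht).const_mul (t - a))

lemma Integrable.tendsto {π : ℕ → Partition a b} {Y Z : ℝ → ℝ} (h : Integrable θ π Y Z)
    {t : ℝ} (ht : t ∈ Set.Icc a b) :
    Filter.Tendsto (fun m => riemannSum θ (π m) Y Z t) Filter.atTop
      (nhds (integral θ π Y Z t)) :=
  h.tendsto_at ht

end Integral

/-! ### Inserting one letter into a word -/

/-- All words arising from a given word by inserting one letter `z`, with multiplicity: the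
shuffles of the word with the one-letter word `z`. -/
def insertions {ι : Type*} (z : ι) : List ι → List (List ι)
  | [] => [[z]]
  | i :: u => (z :: i :: u) :: (insertions z u).map (List.cons i)

lemma length_of_mem_insertions {ι : Type*} {z : ι} {u v : List ι} (h : v ∈ insertions z u) :
    v.length = u.length + 1 := by
  induction u generalizing v with
  | nil => simp_all [insertions]
  | cons i u ih =>
    simp only [insertions, List.mem_cons, List.mem_map] at h
    obtain rfl | ⟨v', hv', rfl⟩ := h
    · simp
    · simp [ih hv']

lemma sum_insertions_replicate {ι M : Type*} [AddCommMonoid M] (z : ι) (f : List ι → M) (k : ℕ) :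
    ((insertions z (List.replicate k z)).map f).sum
      = (k + 1) • f (List.replicate (k + 1) z) := by
  induction k generalizing f with
  | zero => simp [insertions]
  | succ k ih =>
    have h := ih (fun v => f (z :: v))
    rw [List.replicate_succ, insertions, List.map_cons, List.sum_cons, List.map_map]
    rw [show f ∘ List.cons z = fun v => f (z :: v) from rfl, h, succ_nsmul' _ (k + 1)]
    rfl

lemma sum_insertions_replicate_append_cons {ι M : Type*} [AddCommMonoid M] (z i : ι) (u : List ι)
    (f : List ι → M) (k : ℕ) :
    ((insertions z (List.replicate k z ++ i :: u)).map f).sum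
      = (k + 1) • f (List.replicate (k + 1) z ++ i :: u)
        + ((insertions z u).map fun v => f (List.replicate k z ++ i :: v)).sum := by
  induction k generalizing f with
  | zero => simp [insertions, Function.comp_def]
  | succ k ih =>
    have h := ih (fun v => f (z :: v))
    rw [List.replicate_succ, List.cons_append, insertions, List.map_cons, List.sum_cons,
      List.map_map]
    rw [show f ∘ List.cons z = fun v => f (z :: v) from rfl, h, succ_nsmul' _ (k + 1), add_assoc]
    rfl

/-! ### The shuffle identity with the time letter -/

section Shuffle

variable {a b θ : ℝ} {ι : Type*} {π : ℕ → Partition a b} {N : ℕ} {x : ℝ → ι → ℝ}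

lemma continuousOn_iterRev (hx : ∀ i, ContinuousOn (fun t => x t i) (Set.Icc a b))
    (hs : HasSignature θ π N x) {u : List ι} (hu : u.length ≤ N) :
    ContinuousOn (iterRev θ π x u) (Set.Icc a b) := by
  cases u with
  | nil => exact continuousOn_const
  | cons i u =>
    exact (hs u i hu).continuousOn
      (Filter.Frequently.of_forall fun m => continuousOn_riemannSum (π m) _ (hx i))

/-- Linearity of the integral over a finite list of iterated integrals. -/
lemma tendsto_riemannSum_list_sum (hs : HasSignature θ π N x) (i : ι) {t : ℝ}
    (ht : t ∈ Set.Icc a b) (L : List (List ι)) (hL : ∀ v ∈ L, v.length < N) :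
    Filter.Tendsto
      (fun m => riemannSum θ (π m) (fun s => (L.map fun v => iterRev θ π x v s).sum)
        (fun s => x s i) t)
      Filter.atTop (nhds (L.map fun v => iterRev θ π x (i :: v) t).sum) := by
  induction L with
  | nil => simp [riemannSum_zero]
  | cons v L ih =>
    simp only [List.map_cons, List.sum_cons, riemannSum_add]
    exact ((hs v i (hL v (by simp))).tendsto ht).add
      (ih fun v' hv' => hL v' (List.mem_cons_of_mem _ hv'))

/-- The shuffle identity with the time letter `z`: multiplying an iterated integral by the elapsed
time sums up all insertions of `z` into its word. -/
lemma sub_mul_iterRev (hθ : θ ∈ Set.Icc (0 : ℝ) 1)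
    (hπ : Filter.Tendsto (fun m => (π m).mesh) Filter.atTop (nhds 0))
    (hx : ∀ i, ContinuousOn (fun t => x t i) (Set.Icc a b)) (hs : HasSignature θ π N x)
    {z : ι} (hz : ∀ t, x t z = t) {u : List ι} (hu : u.length < N) {t : ℝ}
    (ht : t ∈ Set.Icc a b) :
    (t - a) * iterRev θ π x u t = ((insertions z u).map fun v => iterRev θ π x v t).sum := by
  induction u generalizing t with
  | nil =>
    have h := (hs [] z hu).tendsto ht
    simp only [iterRev, hz, riemannSum_one _ _ ht] at h
    simp only [insertions, iterRev, hz, List.map_cons, List.map_nil, List.sum_cons, List.sum_nil,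
      mul_one, add_zero]
    exact tendsto_nhds_unique tendsto_const_nhds h
  | cons i u ih =>
    rw [List.length_cons] at hu
    have hparts := tendsto_riemannSum_add hθ hπ
      (continuousOn_iterRev hx hs (by omega : u.length ≤ N)) (hx i)
      (continuousOn_iterRev hx hs (by simpa using hu.le : (i :: u).length ≤ N))
      (hs u i (by omega)) ht
    have htime := (hs (i :: u) z (by simpa using hu)).tendsto ht
    simp only [hz] at htime
    have hins := tendsto_riemannSum_list_sum hs i ht (insertions z u)
      (fun v hv => by rw [length_of_mem_insertions hv]; exact hu)
    have hcongr : ∀ m, riemannSum θ (π m)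
        (fun s => ((insertions z u).map fun v => iterRev θ π x v s).sum) (fun s => x s i) t
        = riemannSum θ (π m) (fun s => (s - a) * iterRev θ π x u s) (fun s => x s i) t :=
      fun m => riemannSum_congr (π m) (fun s hs' => (ih (by omega) hs').symm) _ t
    simp only [hcongr] at hins
    have h := tendsto_nhds_unique hparts (hins.add htime)
    rw [h, insertions, List.map_cons, List.sum_cons, List.map_map, add_comm]
    simp only [iterRev, hz, Function.comp_def]

end Shuffle

/-! ### Pruning words with trailing time letters -/

section Pruning

variable {a b θ : ℝ} {d N : ℕ} {π : ℕ → Partition a b}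

lemma continuousOn_timeAugment {X : ℝ → EuclideanSpace ℝ (Fin d)}
    (hX : ContinuousOn X (Set.Icc a b)) (i : Fin (d + 1)) :
    ContinuousOn (fun t => timeAugment X t i) (Set.Icc a b) := by
  refine Fin.cases ?_ (fun j => ?_) i
  · exact continuousOn_id
  · exact (EuclideanSpace.proj (𝕜 := ℝ) j).continuous.comp_continuousOn hX

/-- The shuffle identity on the level of functionals on path space. -/
lemma sub_smul_coord (hab : a ≤ b) (hθ : θ ∈ Set.Icc (0 : ℝ) 1)
    (hπ : Filter.Tendsto (fun m => (π m).mesh) Filter.atTop (nhds 0))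
    {u : List (Fin (d + 1))} (hu : u.length < N) :
    (b - a) • coord d θ π N u.reverse
      = ((insertions 0 u).map fun v => coord d θ π N v.reverse).sum := by
  funext X
  have h := sub_mul_iterRev hθ hπ (continuousOn_timeAugment X.2.1) X.2.2 (z := 0) (fun _ => rfl)
    hu (Set.right_mem_Icc.2 hab)
  rw [Pi.smul_apply, smul_eq_mul, ← Pi.evalAddMonoidHom_apply (fun _ => ℝ) X (List.sum _),
    map_list_sum, List.map_map]
  simpa [coord, sig, Function.comp_def] using h

/-- In reversed notation, `k` is the number of trailing time letters and `u` is what precedes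
them. -/
lemma coord_trailing_zeros_mem (hab : a ≤ b) (hθ : θ ∈ Set.Icc (0 : ℝ) 1)
    (hπ : Filter.Tendsto (fun m => (π m).mesh) Filter.atTop (nhds 0))
    (k : ℕ) (u : List (Fin (d + 1))) (hu : u.head? ≠ some 0) (hN : k + u.length ≤ N) :
    coord d θ π N (List.replicate k 0 ++ u).reverse ∈ Submodule.span ℝ (prunedSet d θ π N) := by
  induction k generalizing u with
  | zero =>
    refine Submodule.subset_span ?_
    cases u with
    | nil => exact Or.inr rfl
    | cons i u =>
      refine Or.inl ⟨(i :: u).reverse, by simpa using hN, ⟨i, by simp, ?_⟩, rfl⟩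
      rintro rfl
      simp at hu
  | succ k ih =>
    have hshuffle := sub_smul_coord (d := d) (N := N) hab hθ hπ
      (u := List.replicate k 0 ++ u) (by simp; omega)
    have hk := Submodule.smul_mem _ (b - a) (ih u hu (by omega))
    -- The shuffle identity puts `k + 1` times the functional in question into the span.
    suffices h : (k + 1) • coord d θ π N (List.replicate (k + 1) 0 ++ u).reverse
        ∈ Submodule.span ℝ (prunedSet d θ π N) by
      rw [← Nat.cast_smul_eq_nsmul ℝ] at h
      exact (Submodule.smul_mem_iff _ (by positivity)).1 h
    rw [hshuffle] at hk
    cases u with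
    | nil =>
      simp only [List.append_nil] at hk ⊢
      rwa [sum_insertions_replicate 0 (fun v => coord d θ π N v.reverse)] at hk
    | cons i u =>
      rw [sum_insertions_replicate_append_cons 0 i u (fun v => coord d θ π N v.reverse)] at hk
      refine (Submodule.add_mem_iff_left _ (list_sum_mem fun f hf => ?_)).1 hk
      obtain ⟨v, hv, rfl⟩ := List.mem_map.1 hf
      refine ih (i :: v) (by simpa using hu) ?_
      rw [List.length_cons, length_of_mem_insertions hv]
      rw [List.length_cons] at hN
      omega

end Pruning

lemma exists_replicate_append {ι : Type*} [DecidableEq ι] (z : ι) (w : List ι) :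
    ∃ k u, w = List.replicate k z ++ u ∧ u.head? ≠ some z := by
  induction w with
  | nil => exact ⟨0, [], by simp⟩
  | cons i w ih =>
    by_cases h : i = z
    · obtain ⟨k, u, rfl, hu⟩ := ih
      exact ⟨k + 1, u, by simp [h, List.replicate_succ], hu⟩
    · exact ⟨0, i :: w, by simp [h]⟩

end PathSignature

theorem mainTheorem3 (d N : ℕ) (a b : ℝ) (hab : a ≤ b) (θ : ℝ) (hθ : θ ∈ Set.Icc (0 : ℝ) 1)
    (π : ℕ → PathSignature.Partition a b)
    (hπ : Filter.Tendsto (fun m => (π m).mesh) Filter.atTop (nhds 0))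
    (w : List (Fin (d + 1))) (hwN : w.length ≤ N) (hw : w.getLast? = some 0) :
    PathSignature.coord d θ π N w ∈
      Submodule.span ℝ (PathSignature.prunedSet d θ π N) := by
  obtain ⟨k, u, hku, hu⟩ := PathSignature.exists_replicate_append 0 w.reverse
  have h := PathSignature.coord_trailing_zeros_mem (N := N) hab hθ hπ k u hu (by
    rw [← List.length_reverse, hku] at hwN
    simpa using hwN)
  rwa [← hku, List.reverse_reverse] at h
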